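/- Consider $n$ processes $P_1,\dots,P_n$, each a deterministic state machine, at most $t$ of which ($0<t<n$) are Byzantine (behave arbitrarily), the others being correct. Processes have local clocks and communicate over a reliable authenticated point-to-point network (possibly with digital signatures, where faulty processes cannot forge signatures of correct ones). The system is partially synchronous: in every execution there is a global stabilization time (GST), unknown to the processes, such that messages between correct processes sent at time $\tau$ are received by time $\max(\tau,\mathrm{GST})+\delta$, where $\delta>0$ is known; correct processes start before or at GST; local clocks may drift arbitrarily before GST and do not drift thereafter; no process takes infinitely many steps in finite time. Let $\mathcal V_I\neq\emptyset$ be the set of values that can be proposed and $\mathcal V_O$ the set of values that can be decided (both possibly infinite). An input configuration is an assignment of proposals from $\mathcal V_I$ to a set of $x$ processes, $n-t\le x\le n$; $\mathcal I$ is the set of all input configurations. An execution corresponds to the input configuration that assigns to exactly the correct processes their proposals. A validity property is a function $\mathit{val}:\mathcal I\to 2^{\mathcal V_O}$ with $\mathit{val}(c)\neq\emptyset$ for every $c\in\mathcal I$. It is solvable if there is an algorithm in whose executions every correct process eventually decides a value of $\mathcal V_O$ (termination), no two correct processes decide different values and no correct process decides more than one value (agreement), and correct processes decide only values in $\mathit{val}(c)$,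 where $c$ is the input configuration to which the execution corresponds. Theorem. If a validity property $\mathit{val}$ is solvable with $n\le 3t$, then it is trivial, i.e., there exists a value $v'\in\mathcal V_O$ such that $v'\in\bigcap_{c\in\mathcal I}\mathit{val}(c)$. -/

import Mathlib

open Filter Topology

universe u v w

namespace ByzantineConsensus

/-! ### Input configurations and validity properties -/

/-- An input configuration: a partial assignment of proposals to the `n` processes
(`c.proposal i = none` plays the role of `⊥`), defined on at least `n - t` of them. -/
structure InputConfig (n t : ℕ) (VI : Type u) where
  proposal : Fin n → Option VI
  card_le : n ≤ (Finset.univ.filter fun i => (proposal i).isSome = true).card + t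

/-- A validity property assigns to every input configuration a nonempty set of
admissible decisions. -/
structure ValidityProperty (n t : ℕ) (VI : Type u) (VO : Type v) where
  admissible : InputConfig n t VI → Set VO
  nonempty : ∀ c, (admissible c).Nonempty

/-- A validity property is trivial if one value is admissible for every input configuration. -/
def ValidityProperty.IsTrivial {n t : ℕ} {VI : Type u} {VO : Type v}
    (val : ValidityProperty n t VI VO) : Prop :=
  ∃ v' : VO, v' ∈ ⋂ c : InputConfig n t VI, val.admissible c

/-! ### Messages with idealized digital signatures -/

/-- A message on the wire: a payload, together with the digital signatures it carries.
The pair `(p, s)` stands for process `p`'s signature of the content `s`.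
A system without a public-key infrastructure is the case where no signature is ever produced. -/
structure Message (n : ℕ) (Payload Content : Type w) where
  payload : Payload
  sigs : Set (Fin n × Content)

/-- What a process asks to be sent: a payload, the contents which it signs with its own key,
and the signatures of other processes which it wants to forward. -/
structure Outgoing (n : ℕ) (Payload Content : Type w) where
  payload : Payload
  sign : Set Content
  forward : Set (Fin n × Content)

/-- The message which process `i` really emits if `seen` is the set of signatures that it has
received so far: own signatures can be created, others can only be forwarded. -/
def Outgoing.toMessage {n : ℕ} {Payload Content : Type w} (o : Outgoing n Payload Content)
    (i : Fin n) (seen : Set (Fin n × Content)) : Message n Payload Content where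
  payload := o.payload
  sigs := {σ | (σ.1 = i ∧ σ.2 ∈ o.sign) ∨ (σ ∈ o.forward ∧ σ ∈ seen)}

/-! ### Algorithms -/

/-- An algorithm with the propose/decide interface: one deterministic state machine for each of
the `n` processes. In one computational step a process reads its local clock, receives a set of
messages, each with the identity of its sender (the network is authenticated), and moves to a new
state; the new state determines at most one message for every process (a batch of messages
is one message with a composite payload) and possibly a decision. -/
structure Algorithm (n : ℕ) (VI : Type u) (VO : Type v) where
  /-- local states -/
  State : Type w
  /-- message payloads -/
  Payload : Type w
  /-- contents that can be signed -/
  Content : Type w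
  /-- granularity of the timers: a process is sure to take a step whenever its local clock shows
  a multiple of `tick` -/
  tick : ℝ
  tick_pos : 0 < tick
  /-- the state of a process which proposes a given value, just before its first step -/
  init : Fin n → VI → State
  /-- new state from the old state, the local clock reading and the messages received -/
  step : Fin n → State → ℝ → Set (Fin n × Message n Payload Content) → State
  /-- message for each addressee -/
  send : Fin n → State → Fin n → Option (Outgoing n Payload Content)
  /-- `some v'` once the process has decided `v'` -/
  decide : Fin n → State → Option VO

variable {n : ℕ} {VI : Type u} {VO : Type v}

/-- Messages of an algorithm. -/
abbrev Algorithm.Msg (A : Algorithm.{u, v, w} n VI VO) : Type w :=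
  Message n A.Payload A.Content

/-! ### Executions -/

/-- The observable data of a run: who is correct, what is proposed, at which real times steps are
taken, what is sent, and when messages are received. Nothing is required of it yet. -/
structure Run (A : Algorithm.{u, v, w} n VI VO) where
  /-- the correct processes; the others are faulty -/
  correct : Finset (Fin n)
  /-- the proposals (without meaning for faulty processes) -/
  proposal : Fin n → VI
  /-- global stabilization time -/
  gst : ℝ
  /-- real time at which a process takes its `k`-th step, `k = 0, 1, …` -/
  time : Fin n → ℕ → ℝ
  /-- reading of the local clock of a process at a real time -/
  clock : Fin n → ℝ → ℝ
  /-- state of a process after its `k`-th step (without meaning for faulty processes) -/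
  state : Fin n → ℕ → A.State
  /-- `out i k j` is the message which `i` sends to `j` in its `k`-th step, if any -/
  out : Fin n → ℕ → Fin n → Option A.Msg
  /-- `arrival i k j = some l` if the message which `i` sends to `j` in its `k`-th step is
  received by `j` in the `l`-th step of `j`; it is `none` if it is never received -/
  arrival : Fin n → ℕ → Fin n → Option ℕ

namespace Run

variable {A : Algorithm.{u, v, w} n VI VO}

/-- The messages (with their senders) received by process `i` in its `l`-th step. -/
def inbox (R : Run A) (i : Fin n) (l : ℕ) : Set (Fin n × A.Msg) :=
  {p | ∃ k, R.out p.1 k i = some p.2 ∧ R.arrival p.1 k i = some l}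

/-- The signatures received by process `i` in its steps `0, …, k`. -/
def seen (R : Run A) (i : Fin n) (k : ℕ) : Set (Fin n × A.Content) :=
  {σ | ∃ l ≤ k, ∃ p ∈ R.inbox i l, σ ∈ p.2.sigs}

/-- Process `i` decides `v'` at some point. -/
def Decides (R : Run A) (i : Fin n) (v' : VO) : Prop :=
  ∃ k, A.decide i (R.state i k) = some v'

/-- A run is an (infinite) execution of `A` in a partially synchronous system with at most `t`
Byzantine processes and message delay bound `δ` after the global stabilization time. -/
structure IsExecution (R : Run A) (t : ℕ) (δ : ℝ) : Prop where
  /-- at most `t` processes are faulty -/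
  card_le : n ≤ R.correct.card + t
  gst_nonneg : 0 ≤ R.gst
  time_nonneg : ∀ i, 0 ≤ R.time i 0
  time_strictMono : ∀ i, StrictMono (R.time i)
  /-- no process takes infinitely many steps in finite time -/
  time_unbounded : ∀ i, Tendsto (R.time i) atTop atTop
  /-- correct processes start before or at the global stabilization time -/
  start_le : ∀ i ∈ R.correct, R.time i 0 ≤ R.gst
  clock_continuous : ∀ i ∈ R.correct, Continuous (R.clock i)
  clock_strictMono : ∀ i ∈ R.correct, StrictMono (R.clock i)
  /-- local clocks do not drift after the global stabilization time -/
  clock_sync : ∀ i ∈ R.correct, ∀ τ, R.gst ≤ τ → R.clock i τ = R.clock i R.gst + (τ - R.gst)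
  /-- correct processes take a step whenever their local clock ticks -/
  clock_tick : ∀ i ∈ R.correct, ∀ τ, R.time i 0 ≤ τ → ∀ m : ℤ, R.clock i τ = m * A.tick →
    ∃ k, R.time i k = τ
  /-- messages are received after they have been sent -/
  causal : ∀ i k j l, R.arrival i k j = some l → R.time i k < R.time j l
  /-- messages between correct processes are received, by time `max (sending time, GST) + δ` -/
  timely : ∀ i ∈ R.correct, ∀ j ∈ R.correct, ∀ k, (R.out i k j).isSome = true →
    ∃ l, R.arrival i k j = some l ∧ R.time j l ≤ max (R.time i k) R.gst + δ
  /-- correct processes follow the algorithm: first step -/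
  state_zero : ∀ i ∈ R.correct, R.state i 0 =
    A.step i (A.init i (R.proposal i)) (R.clock i (R.time i 0)) (R.inbox i 0)
  /-- correct processes follow the algorithm: later steps -/
  state_succ : ∀ i ∈ R.correct, ∀ k, R.state i (k + 1) =
    A.step i (R.state i k) (R.clock i (R.time i (k + 1))) (R.inbox i (k + 1))
  /-- correct processes follow the algorithm: sending -/
  out_eq : ∀ i ∈ R.correct, ∀ k j, R.out i k j =
    (A.send i (R.state i k) j).map fun o => o.toMessage i (R.seen i k)
  /-- faulty processes send arbitrary messages, but cannot forge signatures of correct processes: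
  each such signature has been sent to some faulty process before -/
  unforgeable : ∀ i ∉ R.correct, ∀ k j m, R.out i k j = some m →
    ∀ σ ∈ m.sigs, σ.1 ∈ R.correct →
      ∃ p ∈ R.correct, ∃ q ∉ R.correct, ∃ k' m', R.out p k' q = some m' ∧ σ ∈ m'.sigs ∧
        R.time p k' < R.time i k

/-- The input configuration to which an execution corresponds: it assigns their proposals to
exactly the correct processes. -/
def inputConf (R : Run A) {t : ℕ} {δ : ℝ} (hR : R.IsExecution t δ) : InputConfig n t VI where
  proposal i := if i ∈ R.correct then some (R.proposal i) else none
  card_le := by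
    have h : (Finset.univ.filter fun i =>
        (if i ∈ R.correct then some (R.proposal i) else none).isSome = true) = R.correct := by
      ext i
      by_cases hi : i ∈ R.correct <;> simp [hi]
    rw [h]
    exact hR.card_le

end Run

/-! ### Consensus -/

/-- `A` solves consensus with the validity property `val`, in partial synchrony with known bound
`δ` and at most `t` Byzantine processes. -/
structure Algorithm.Solves (A : Algorithm.{u, v, w} n VI VO) {t : ℕ} (δ : ℝ)
    (val : ValidityProperty n t VI VO) : Prop where
  /-- every correct process eventually decides -/
  termination : ∀ R : Run A, R.IsExecution t δ → ∀ i ∈ R.correct, ∃ v', R.Decides i v'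
  /-- no two different values are decided by correct processes (nor by a single one) -/
  agreement : ∀ R : Run A, R.IsExecution t δ → ∀ i ∈ R.correct, ∀ j ∈ R.correct,
    ∀ v₁ v₂, R.Decides i v₁ → R.Decides j v₂ → v₁ = v₂
  /-- correct processes decide only admissible values -/
  validity : ∀ (R : Run A) (hR : R.IsExecution t δ), ∀ i ∈ R.correct, ∀ v',
    R.Decides i v' → v' ∈ val.admissible (R.inputConf hR)

/-- A validity property is solvable if some algorithm solves consensus with it. -/
def ValidityProperty.Solvable {t : ℕ} (val : ValidityProperty n t VI VO) (δ : ℝ) : Prop :=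
  ∃ A : Algorithm.{u, v, w} n VI VO, A.Solves δ val

end ByzantineConsensus

/-!
The proof is the classical partition argument, in a form that reaches every input configuration.

All executions proceed in lockstep: every process takes its `k`-th step at real time `k * h`, where
`h ≤ δ` divides the timer granularity, and local clocks show real time. For a set `Q` of processes
and proposals `x`, the quiet run `quietRun A h Q x` has `Q` correct, all other processes silent,
and every message received in the next round.

The key is `exists_execution_imitating`. Let `P` be a set of at least `n - t` processes, and let
`Q₁`, `Q₂` have no common point in `P`. For every round `K`, there is an execution with correct set
`P` in which, up to round `K`, the processes in `P ∩ Q₁` behave as in a quiet run of `Q₁`, and those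
in `P ∩ Q₂` as in a quiet run of `Q₂`. Global stabilization happens at round `K`; until then,
messages between correct processes from different groups are withheld, while a faulty process
replays to each group what it sends in the quiet run of that group. This forges no signature: a
signature of a correct process which appears in a faulty process's message of a quiet run has
reached the faulty processes from a correct one (`exists_signature_source`).

Since `n ≤ 3 * t`, the processes are covered by `Q₁` and `Q₂`, whose complements are nonempty and
have at most `t` elements, and with `|Q₁ ∩ Q₂| ≤ t`. With `P = (Q₁ ∩ Q₂)ᶜ`, agreement forces the
decisions in all quiet runs of `Q₁` and `Q₂`, whatever is proposed, to be one value `v`. Finally,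
the set `P` of an arbitrary input configuration meets `Q₁` or `Q₂`, say `Q`; an execution with this
input configuration in which `P ∩ Q` imitates a quiet run of `Q` until it has decided shows that
`v` is admissible.
-/

namespace ByzantineConsensus

variable {n : ℕ} {VI : Type u} {VO : Type v}

/-! ### Lockstep runs -/

section Lockstep

variable (A : Algorithm.{u, v, w} n VI VO) (P : Finset (Fin n)) (x : Fin n → VI) (h : ℝ)
  (arr : Fin n → ℕ → Fin n → Option ℕ) (adv : Fin n → ℕ → Fin n → Option A.Msg)

/-- The state of process `i` after round `l`, and the signatures it has received by then, when
round `k` takes place at time `k * h`, messages arrive according to `arr`, and the processes outside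
`P` send the messages prescribed by `adv`. No message can arrive in round `0`. -/
def lockstepNode : ℕ → Fin n → A.State × Set (Fin n × A.Content)
  | 0, i => (A.step i (A.init i (x i)) 0 ∅, ∅)
  | l + 1, i =>
    let inbox : Set (Fin n × A.Msg) := {p | ∃ k, ∃ _ : k < l + 1,
      (if p.1 ∈ P then
        (A.send p.1 (lockstepNode k p.1).1 i).map fun o => o.toMessage p.1 (lockstepNode k p.1).2
        else adv p.1 k i) = some p.2 ∧ arr p.1 k i = some (l + 1)}
    (A.step i (lockstepNode l i).1 ((l + 1 : ℕ) * h) inbox,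
      (lockstepNode l i).2 ∪ {σ | ∃ p ∈ inbox, σ ∈ p.2.sigs})
termination_by l => l

/-- The run in which every process takes its `k`-th step at time `k * h`, with correct processes
`P`, stabilization at round `K`, arrivals `arr`, and messages `adv` from the faulty processes. -/
def lockstepRun (K : ℕ) : Run A where
  correct := P
  proposal := x
  gst := K * h
  time _ k := k * h
  clock _ τ := τ
  state i k := (lockstepNode A P x h arr adv k i).1
  out i k j :=
    if i ∈ P then
      (A.send i (lockstepNode A P x h arr adv k i).1 j).map
        fun o => o.toMessage i (lockstepNode A P x h arr adv k i).2
    else adv i k j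
  arrival := arr

variable {A P x h arr adv} {K : ℕ}

lemma lockstepRun_out_of_notMem {i : Fin n} (hi : i ∉ P) (k : ℕ) (j : Fin n) :
    (lockstepRun A P x h arr adv K).out i k j = adv i k j := if_neg hi

section Causal

variable (harr : ∀ i k j l, arr i k j = some l → k < l)
include harr

lemma lockstepRun_inbox_zero (i : Fin n) :
    (lockstepRun A P x h arr adv K).inbox i 0 = ∅ := by
  ext p
  simp only [Run.inbox, Set.mem_ofPred_eq, Set.mem_empty_iff_false, iff_false]
  rintro ⟨k, -, hk⟩
  exact absurd (harr _ _ _ _ hk) (Nat.not_lt_zero _)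

lemma lockstepNode_succ (l : ℕ) (i : Fin n) :
    lockstepNode A P x h arr adv (l + 1) i =
      (A.step i (lockstepNode A P x h arr adv l i).1 ((l + 1 : ℕ) * h)
        ((lockstepRun A P x h arr adv K).inbox i (l + 1)),
      (lockstepNode A P x h arr adv l i).2 ∪
        {σ | ∃ p ∈ (lockstepRun A P x h arr adv K).inbox i (l + 1), σ ∈ p.2.sigs}) := by
  have key : (lockstepRun A P x h arr adv K).inbox i (l + 1) =
      {p | ∃ k, ∃ _ : k < l + 1,
      (if p.1 ∈ P then
        (A.send p.1 (lockstepNode A P x h arr adv k p.1).1 i).map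
          fun o => o.toMessage p.1 (lockstepNode A P x h arr adv k p.1).2
        else adv p.1 k i) = some p.2 ∧ arr p.1 k i = some (l + 1)} := by
    ext p
    constructor
    · rintro ⟨k, h1, h2⟩
      exact ⟨k, harr _ _ _ _ h2, h1, h2⟩
    · rintro ⟨k, -, h1, h2⟩
      exact ⟨k, h1, h2⟩
  rw [key, lockstepNode]

lemma lockstepNode_seen (k : ℕ) (i : Fin n) :
    (lockstepNode A P x h arr adv k i).2 = (lockstepRun A P x h arr adv K).seen i k := by
  induction k with
  | zero =>
    ext σ
    simp [lockstepNode, Run.seen, lockstepRun_inbox_zero harr]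
  | succ l ih =>
    rw [lockstepNode_succ harr (K := K), ih]
    ext σ
    constructor
    · rintro (⟨l', hl', hp⟩ | hp)
      · exact ⟨l', by omega, hp⟩
      · exact ⟨l + 1, le_rfl, hp⟩
    · rintro ⟨l', hl', hp⟩
      rcases Nat.lt_or_ge l l' with hlt | hle
      · obtain rfl : l' = l + 1 := by omega
        exact Or.inr hp
      · exact Or.inl ⟨l', hle, hp⟩

lemma lockstepRun_state_zero (i : Fin n) :
    (lockstepRun A P x h arr adv K).state i 0 =
      A.step i (A.init i (x i)) 0 ((lockstepRun A P x h arr adv K).inbox i 0) := by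
  rw [lockstepRun_inbox_zero harr]
  simp [lockstepRun, lockstepNode]

lemma lockstepRun_state_succ (i : Fin n) (k : ℕ) :
    (lockstepRun A P x h arr adv K).state i (k + 1) =
      A.step i ((lockstepRun A P x h arr adv K).state i k) ((k + 1 : ℕ) * h)
        ((lockstepRun A P x h arr adv K).inbox i (k + 1)) :=
  congrArg Prod.fst (lockstepNode_succ harr k i)

lemma lockstepRun_out_of_mem {i : Fin n} (hi : i ∈ P) (k : ℕ) (j : Fin n) :
    (lockstepRun A P x h arr adv K).out i k j =
      (A.send i ((lockstepRun A P x h arr adv K).state i k) j).map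
        fun o => o.toMessage i ((lockstepRun A P x h arr adv K).seen i k) := by
  rw [← lockstepNode_seen harr]
  exact if_pos hi

lemma lockstepRun_isExecution {t N : ℕ} {δ : ℝ} (hh : 0 < h) (hδ : h ≤ δ)
    (htick : A.tick = N * h) (hP : n ≤ P.card + t)
    (htimely : ∀ i ∈ P, ∀ j ∈ P, ∀ k, ∃ l, arr i k j = some l ∧ l ≤ max k K + 1)
    (hsig : ∀ i ∉ P, ∀ k j m, adv i k j = some m → ∀ σ ∈ m.sigs, σ.1 ∈ P →
      ∃ p ∈ P, ∃ q ∉ P, ∃ k' m', (lockstepRun A P x h arr adv K).out p k' q = some m' ∧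
        σ ∈ m'.sigs ∧ k' < k) :
    (lockstepRun A P x h arr adv K).IsExecution t δ where
  card_le := hP
  gst_nonneg := by simp only [lockstepRun]; positivity
  time_nonneg i := by simp [lockstepRun]
  time_strictMono i a b hab := by
    have : (a : ℝ) < b := by exact_mod_cast hab
    exact mul_lt_mul_of_pos_right this hh
  time_unbounded i := tendsto_natCast_atTop_atTop.atTop_mul_const hh
  start_le i _ := by
    have : (0 : ℝ) ≤ K * h := by positivity
    simpa [lockstepRun] using this
  clock_continuous i _ := continuous_id
  clock_strictMono i _ := strictMono_id
  clock_sync i _ τ _ := by simp [lockstepRun]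
  clock_tick i _ τ hτ m hm := by
    simp only [lockstepRun, Nat.cast_zero, zero_mul] at hτ hm ⊢
    have hm0 : 0 ≤ m := by
      have h0 : 0 ≤ (m : ℝ) := by
        by_contra hneg
        have := mul_neg_of_neg_of_pos (not_le.mp hneg) A.tick_pos
        linarith
      exact_mod_cast h0
    lift m to ℕ using hm0
    refine ⟨m * N, ?_⟩
    rw [hm, htick]
    push_cast
    ring
  causal i k j l hl := by
    have : (k : ℝ) < l := by exact_mod_cast harr i k j l hl
    exact mul_lt_mul_of_pos_right this hh
  timely i hi j hj k _ := by
    obtain ⟨l, hl, hle⟩ := htimely i hi j hj k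
    refine ⟨l, hl, ?_⟩
    have hle' : (l : ℝ) ≤ max (k : ℝ) K + 1 := by exact_mod_cast hle
    calc (l : ℝ) * h ≤ (max (k : ℝ) K + 1) * h := mul_le_mul_of_nonneg_right hle' hh.le
      _ = max ((k : ℝ) * h) (K * h) + h := by rw [add_mul, one_mul, max_mul_of_nonneg _ _ hh.le]
      _ ≤ max ((k : ℝ) * h) (K * h) + δ := by gcongr
  state_zero i _ := by
    rw [lockstepRun_state_zero harr]
    simp [lockstepRun]
  state_succ i _ k := lockstepRun_state_succ harr i k
  out_eq i hi k j := lockstepRun_out_of_mem harr hi k j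
  unforgeable i hi k j m hm σ hσ hσP := by
    have hi : i ∉ P := hi
    rw [lockstepRun_out_of_notMem hi] at hm
    obtain ⟨p, hp, q, hq, k', m', h1, h2, h3⟩ := hsig i hi k j m hm σ hσ hσP
    have : (k' : ℝ) < k := by exact_mod_cast h3
    exact ⟨p, hp, q, hq, k', m', h1, h2, mul_lt_mul_of_pos_right this hh⟩

end Causal

end Lockstep

/-! ### Quiet runs and their imitation -/

/-- The lockstep run in which the processes in `Q` are correct, all others are silent, and every
message is received in the round after it was sent. -/
def quietRun (A : Algorithm.{u, v, w} n VI VO) (h : ℝ) (Q : Finset (Fin n)) (x : Fin n → VI) :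
    Run A :=
  lockstepRun A Q x h (fun _ k _ => some (k + 1)) (fun _ _ _ => none) 0

section Quiet

variable {A : Algorithm.{u, v, w} n VI VO} {h : ℝ} {Q : Finset (Fin n)} {x : Fin n → VI}

lemma quietRun_arrival_causal (i : Fin n) (k : ℕ) (j : Fin n) (l : ℕ)
    (hl : (fun (_ : Fin n) (k : ℕ) (_ : Fin n) => some (k + 1)) i k j = some l) : k < l := by
  simp only [Option.some.injEq] at hl
  omega

lemma quietRun_out_of_notMem {i : Fin n} (hi : i ∉ Q) (k : ℕ) (j : Fin n) :
    (quietRun A h Q x).out i k j = none := lockstepRun_out_of_notMem hi k j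

lemma quietRun_isExecution {t N : ℕ} {δ : ℝ} (hh : 0 < h) (hδ : h ≤ δ)
    (htick : A.tick = N * h) (hQ : n ≤ Q.card + t) :
    (quietRun A h Q x).IsExecution t δ :=
  lockstepRun_isExecution quietRun_arrival_causal hh hδ htick hQ
    (fun _ _ _ _ k => ⟨k + 1, rfl, by omega⟩) (fun _ _ _ _ _ hm => by cases hm)

/-- In a quiet run, a signature of a process in `P` which is sent by a process outside `P` has
crossed from `P` to its complement in an earlier round. -/
lemma exists_signature_source (P : Finset (Fin n)) (k : ℕ) : ∀ i ∉ P, ∀ j m,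
    (quietRun A h Q x).out i k j = some m → ∀ σ ∈ m.sigs, σ.1 ∈ P →
      ∃ p ∈ P, ∃ q ∉ P, ∃ k' m', (quietRun A h Q x).out p k' q = some m' ∧
        σ ∈ m'.sigs ∧ k' < k := by
  induction k using Nat.strong_induction_on with
  | _ k ih =>
    intro i hi j m hm σ hσ hσP
    by_cases hiQ : i ∈ Q
    · have hm' := hm
      rw [quietRun, lockstepRun_out_of_mem quietRun_arrival_causal hiQ] at hm'
      obtain ⟨o, -, rfl⟩ := Option.map_eq_some_iff.mp hm'
      rcases hσ with ⟨rfl, -⟩ | ⟨-, l, hl, ⟨p, m'⟩, ⟨k', hk', harr⟩, hσm⟩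
      · exact absurd hσP hi
      · have hlt : k' < k := (quietRun_arrival_causal p k' i l harr).trans_le hl
        by_cases hp : p ∈ P
        · exact ⟨p, hp, i, hi, k', m', hk', hσm, hlt⟩
        · obtain ⟨p', hp', q, hq, k'', m'', h1, h2, h3⟩ :=
            ih k' hlt p hp i m' hk' σ hσm hσP
          exact ⟨p', hp', q, hq, k'', m'', h1, h2, h3.trans hlt⟩
    · rw [quietRun_out_of_notMem hiQ] at hm
      cases hm

/-- Indistinguishability: in a lockstep run with correct set `P`, the processes in `P ∩ Q` behave
up to round `K` as in the quiet run of `Q`, provided that until then they receive nothing from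
outside `Q`, that messages from `Q` take one round, and that the faulty processes in `Q` send
them what they send in the quiet run. -/
lemma lockstepRun_imitates {P : Finset (Fin n)} {y : Fin n → VI}
    {arr : Fin n → ℕ → Fin n → Option ℕ} {adv : Fin n → ℕ → Fin n → Option A.Msg} {K : ℕ}
    (harr : ∀ i k j l, arr i k j = some l → k < l)
    (hxy : ∀ i ∈ P, i ∈ Q → y i = x i)
    (hin : ∀ i ∈ P, i ∈ Q → ∀ p ∈ Q, ∀ k, arr p k i = some (k + 1))
    (hout : ∀ i ∈ P, i ∈ Q → ∀ p ∈ P, p ∉ Q → ∀ k l, arr p k i = some l → K < l)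
    (hadv : ∀ i ∈ P, i ∈ Q → ∀ p ∉ P, ∀ k < K,
      adv p k i = (quietRun A h Q x).out p k i)
    (k : ℕ) (hk : k ≤ K) (i : Fin n) (hi : i ∈ P) (hiQ : i ∈ Q) :
    (lockstepRun A P y h arr adv K).state i k = (quietRun A h Q x).state i k ∧
      ∀ j, (lockstepRun A P y h arr adv K).out i k j = (quietRun A h Q x).out i k j := by
  induction k using Nat.strong_induction_on generalizing i with
  | _ k ih =>
    have hinbox : ∀ l ≤ k, (lockstepRun A P y h arr adv K).inbox i l =
        (quietRun A h Q x).inbox i l := by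
      intro l hl
      ext ⟨p, m⟩
      constructor
      · rintro ⟨k', hm, ha⟩
        have ha : arr p k' i = some l := ha
        have hlt : k' < l := harr _ _ _ _ ha
        by_cases hp : p ∈ P
        · by_cases hpQ : p ∈ Q
          · rw [hin i hi hiQ p hpQ] at ha
            exact ⟨k', by rw [← hm]; exact ((ih k' (by omega) (by omega) p hp hpQ).2 i).symm, ha⟩
          · have := hout i hi hiQ p hp hpQ _ _ ha
            omega
        · have hm : (lockstepRun A P y h arr adv K).out p k' i = some m := hm
          rw [lockstepRun_out_of_notMem hp, hadv i hi hiQ p hp k' (by omega)] at hm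
          by_cases hpQ : p ∈ Q
          · rw [hin i hi hiQ p hpQ] at ha
            exact ⟨k', hm, ha⟩
          · rw [quietRun_out_of_notMem hpQ] at hm
            cases hm
      · rintro ⟨k', hm, ha⟩
        have hlt : k' < l := quietRun_arrival_causal p k' i l ha
        have hm : (quietRun A h Q x).out p k' i = some m := hm
        by_cases hpQ : p ∈ Q
        · refine ⟨k', ?_, (hin i hi hiQ p hpQ k').trans ha⟩
          change (lockstepRun A P y h arr adv K).out p k' i = some m
          by_cases hp : p ∈ P
          · rw [(ih k' (by omega) (by omega) p hp hpQ).2 i, hm]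
          · rw [lockstepRun_out_of_notMem hp, hadv i hi hiQ p hp k' (by omega), hm]
        · rw [quietRun_out_of_notMem hpQ] at hm
          cases hm
    have hseen : (lockstepRun A P y h arr adv K).seen i k = (quietRun A h Q x).seen i k := by
      ext σ
      simp only [Run.seen, Set.mem_ofPred_eq]
      refine exists_congr fun l => and_congr_right fun hl => ?_
      rw [hinbox l hl]
    have hstate : (lockstepRun A P y h arr adv K).state i k = (quietRun A h Q x).state i k := by
      cases k with
      | zero =>
        rw [lockstepRun_state_zero harr, hinbox 0 le_rfl, hxy i hi hiQ]
        exact (lockstepRun_state_zero quietRun_arrival_causal i).symm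
      | succ k =>
        rw [lockstepRun_state_succ harr, hinbox _ le_rfl,
          (ih k (by omega) (by omega) i hi hiQ).1]
        exact (lockstepRun_state_succ quietRun_arrival_causal i k).symm
    refine ⟨hstate, fun j => ?_⟩
    rw [lockstepRun_out_of_mem harr hi, hstate, hseen]
    exact (lockstepRun_out_of_mem quietRun_arrival_causal hiQ k j).symm

end Quiet

/-- Until round `K`, the correct processes in `Q₁` cannot tell the execution from a quiet run of
`Q₁`, nor those in `Q₂` from a quiet run of `Q₂`. For `Q₂ = ∅` there is only one group, and all
other correct processes are cut off from it until round `K`. -/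
lemma exists_execution_imitating {A : Algorithm.{u, v, w} n VI VO} {t N : ℕ} {h δ : ℝ}
    (hh : 0 < h) (hδ : h ≤ δ) (htick : A.tick = N * h) {P Q₁ Q₂ : Finset (Fin n)}
    (hP : n ≤ P.card + t) (hdisj : ∀ i ∈ P, i ∈ Q₁ → i ∉ Q₂) {y x₁ x₂ : Fin n → VI}
    (hy₁ : ∀ i ∈ P, i ∈ Q₁ → y i = x₁ i) (hy₂ : ∀ i ∈ P, i ∈ Q₂ → y i = x₂ i) (K : ℕ) :
    ∃ R : Run A, R.IsExecution t δ ∧ R.correct = P ∧ R.proposal = y ∧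
      (∀ k ≤ K, ∀ i ∈ P, i ∈ Q₁ → R.state i k = (quietRun A h Q₁ x₁).state i k) ∧
      (∀ k ≤ K, ∀ i ∈ P, i ∈ Q₂ → R.state i k = (quietRun A h Q₂ x₂).state i k) := by
  let arr : Fin n → ℕ → Fin n → Option ℕ := fun i k j =>
    if (i ∈ Q₁ ∧ j ∈ Q₁) ∨ (i ∈ Q₂ ∧ j ∈ Q₂) then some (k + 1) else some (max k K + 1)
  -- Silence from round `K` on: the correct processes may then leave the quiet runs, and a faulty
  -- process that went on replaying might show signatures which have never been issued.
  let adv : Fin n → ℕ → Fin n → Option A.Msg := fun i k j =>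
    if k < K then
      if j ∈ Q₁ then (quietRun A h Q₁ x₁).out i k j else (quietRun A h Q₂ x₂).out i k j
    else none
  have harr : ∀ i k j l, arr i k j = some l → k < l := by
    intro i k j l hl
    simp only [arr] at hl
    split_ifs at hl <;> simp only [Option.some.injEq] at hl <;> omega
  have h1 := lockstepRun_imitates (A := A) (h := h) (Q := Q₁) (x := x₁) (adv := adv) (K := K)
    harr hy₁
    (fun i _ hi p hp k => if_pos (Or.inl ⟨hp, hi⟩))
    (fun i hi hi1 p _ hp k l hl => by
      have hi2 := hdisj i hi hi1
      simp only [arr, hp, hi2, false_and, and_false, or_self, if_false, Option.some.injEq] at hl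
      omega)
    (fun i _ hi p _ k hk => by simp only [adv, hk, hi, if_true])
  have h2 := lockstepRun_imitates (A := A) (h := h) (Q := Q₂) (x := x₂) (adv := adv) (K := K)
    harr hy₂
    (fun i _ hi p hp k => if_pos (Or.inr ⟨hp, hi⟩))
    (fun i hi hi2 p _ hp k l hl => by
      have hi1 : i ∉ Q₁ := fun hi1 => hdisj i hi hi1 hi2
      simp only [arr, hp, hi1, false_and, and_false, or_self, if_false, Option.some.injEq] at hl
      omega)
    (fun i hi hi2 p _ k hk => by
      have hi1 : i ∉ Q₁ := fun hi1 => hdisj i hi hi1 hi2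
      simp only [adv, hk, hi1, if_true, if_false])
  refine ⟨lockstepRun A P y h arr adv K,
    lockstepRun_isExecution harr hh hδ htick hP ?_ ?_, rfl, rfl,
    fun k hk i hi hi1 => (h1 k hk i hi hi1).1, fun k hk i hi hi2 => (h2 k hk i hi hi2).1⟩
  · intro i _ j _ k
    by_cases hc : (i ∈ Q₁ ∧ j ∈ Q₁) ∨ (i ∈ Q₂ ∧ j ∈ Q₂)
    · exact ⟨k + 1, if_pos hc, by omega⟩
    · exact ⟨max k K + 1, if_neg hc, le_rfl⟩
  · intro i hi k j m hm σ hσ hσP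
    simp only [adv] at hm
    -- The source found in a quiet run is a correct process before round `K`, and so it sends the
    -- same message in the combined run.
    split_ifs at hm with hkK hj
    · obtain ⟨p, hp, q, hq, k', m', e1, e2, e3⟩ :=
        exists_signature_source P k i hi j m hm σ hσ hσP
      have hpQ : p ∈ Q₁ := by
        by_contra hpQ
        rw [quietRun_out_of_notMem hpQ] at e1
        cases e1
      exact ⟨p, hp, q, hq, k', m', by rw [(h1 k' (by omega) p hp hpQ).2 q, e1], e2, e3⟩
    · obtain ⟨p, hp, q, hq, k', m', e1, e2, e3⟩ :=
        exists_signature_source P k i hi j m hm σ hσ hσP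
      have hpQ : p ∈ Q₂ := by
        by_contra hpQ
        rw [quietRun_out_of_notMem hpQ] at e1
        cases e1
      exact ⟨p, hp, q, hq, k', m', by rw [(h2 k' (by omega) p hp hpQ).2 q, e1], e2, e3⟩

/-! ### Decisions of quiet runs -/

section Decisions

variable {A : Algorithm.{u, v, w} n VI VO} {t N : ℕ} {h δ : ℝ} {val : ValidityProperty n t VI VO}

/-- The partition argument: if at most `t` processes lie in both `Q₁` and `Q₂`, then these can be
faulty and keep the remaining processes of `Q₁` and of `Q₂` apart, so that agreement identifies
the decisions of the two groups. -/
lemma quietRun_decides_eq (hA : A.Solves δ val) (hh : 0 < h) (hδ : h ≤ δ)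
    (htick : A.tick = N * h) {Q₁ Q₂ : Finset (Fin n)} (hQ : n ≤ (Q₁ ∩ Q₂)ᶜ.card + t)
    {x₁ x₂ : Fin n → VI} {i j : Fin n} (hi : i ∈ Q₁ \ Q₂) (hj : j ∈ Q₂ \ Q₁) {v₁ v₂ : VO}
    (h₁ : (quietRun A h Q₁ x₁).Decides i v₁) (h₂ : (quietRun A h Q₂ x₂).Decides j v₂) :
    v₁ = v₂ := by
  obtain ⟨k₁, hk₁⟩ := h₁
  obtain ⟨k₂, hk₂⟩ := h₂
  rw [Finset.mem_sdiff] at hi hj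
  have hiP : i ∈ (Q₁ ∩ Q₂)ᶜ := by simp [hi.2]
  have hjP : j ∈ (Q₁ ∩ Q₂)ᶜ := by simp [hj.2]
  have hdisj : ∀ p ∈ (Q₁ ∩ Q₂)ᶜ, p ∈ Q₁ → p ∉ Q₂ := by
    intro p hp hp1 hp2
    simp [hp1, hp2] at hp
  obtain ⟨R, hR, hc, -, e₁, e₂⟩ := exists_execution_imitating (A := A) hh hδ htick hQ hdisj
    (y := fun p => if p ∈ Q₁ then x₁ p else x₂ p) (x₁ := x₁) (x₂ := x₂)
    (fun p _ hp => if_pos hp) (fun p hp hp2 => if_neg fun hp1 => hdisj p hp hp1 hp2) (max k₁ k₂)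
  refine hA.agreement R hR i (hc ▸ hiP) j (hc ▸ hjP) v₁ v₂ ⟨k₁, ?_⟩ ⟨k₂, ?_⟩
  · rw [e₁ k₁ (le_max_left _ _) i hiP hi.1, hk₁]
  · rw [e₂ k₂ (le_max_right _ _) j hjP hj.1, hk₂]

/-- If all quiet runs of `Q` lead to the decision `v'`, then `v'` is admissible for all input
configurations in which some process of `Q` is correct. -/
lemma mem_admissible_of_quietRun_decides [Nonempty VI] (hA : A.Solves δ val) (hh : 0 < h)
    (hδ : h ≤ δ) (htick : A.tick = N * h) {Q : Finset (Fin n)} {v' : VO}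
    {c : InputConfig n t VI} {i : Fin n} (hi : i ∈ Q) (hic : (c.proposal i).isSome = true)
    (hv : ∀ x, (quietRun A h Q x).Decides i v') :
    v' ∈ val.admissible c := by
  let y : Fin n → VI := fun p => (c.proposal p).getD (Classical.arbitrary VI)
  obtain ⟨k, hk⟩ := hv y
  obtain ⟨R, hR, hc, hp, e, -⟩ := exists_execution_imitating (A := A) hh hδ htick
    (P := Finset.univ.filter fun i => (c.proposal i).isSome = true) (Q₁ := Q) (Q₂ := ∅)
    (y := y) (x₁ := y) (x₂ := y) c.card_le (by simp) (fun _ _ _ => rfl) (fun _ _ _ => rfl) k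
  have hiP : i ∈ Finset.univ.filter fun i => (c.proposal i).isSome = true := by simp [hic]
  have hmem := hA.validity R hR i (hc ▸ hiP) v' ⟨k, by rw [e k le_rfl i hiP hi, hk]⟩
  have hconf : R.inputConf hR = c := by
    have hprop : (R.inputConf hR).proposal = c.proposal := by
      funext p
      simp only [Run.inputConf, hc, hp, y, Finset.mem_filter, Finset.mem_univ, true_and]
      cases c.proposal p <;> simp
    cases c
    cases hRc : R.inputConf hR
    rw [hRc] at hprop
    cases hprop
    rfl
  rwa [hconf] at hmem

end Decisions

/-- Two proper subsets cover the processes such that each of them leaves out at most `t` processes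
and at most `t` processes lie in both. -/
lemma exists_cover {n t : ℕ} (ht : 0 < t) (htn : t < n) (hn : n ≤ 3 * t) :
    ∃ Q₁ Q₂ : Finset (Fin n), n ≤ Q₁.card + t ∧ n ≤ Q₂.card + t ∧
      n ≤ (Q₁ ∩ Q₂)ᶜ.card + t ∧ (Q₁ \ Q₂).Nonempty ∧ (Q₂ \ Q₁).Nonempty ∧
      ∀ i, i ∈ Q₁ ∨ i ∈ Q₂ := by
  -- `Q₁` consists of the first `b` processes, and `Q₂` leaves out the first `a`.
  obtain ⟨a, b, ha, hab, hbn, hat, hba, hnb⟩ : ∃ a b : ℕ, 0 < a ∧ a ≤ b ∧ b < n ∧ a ≤ t ∧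
      b ≤ a + t ∧ n ≤ b + t := by
    by_cases h2 : n ≤ 2 * t
    · exact ⟨n - t, n - t, by omega, by omega, by omega, by omega, by omega, by omega⟩
    · exact ⟨t, n - t, by omega, by omega, by omega, by omega, by omega, by omega⟩
  have hlt : ∀ m, m ≤ n → (Finset.univ.filter fun i : Fin n => (i : ℕ) < m).card = m := by
    intro m hm
    rw [Fin.card_filter_val_lt]
    omega
  have hge : ∀ m, m ≤ n → (Finset.univ.filter fun i : Fin n => m ≤ (i : ℕ)).card = n - m := by
    intro m hm
    have := Finset.card_filter_add_card_filter_not (s := Finset.univ) fun i : Fin n => (i : ℕ) < m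
    simp only [not_lt, Finset.card_univ, Fintype.card_fin] at this
    rw [hlt m hm] at this
    omega
  refine ⟨Finset.univ.filter fun i => (i : ℕ) < b, Finset.univ.filter fun i => a ≤ (i : ℕ),
    ?_, ?_, ?_, ⟨⟨0, by omega⟩, ?_⟩, ⟨⟨b, hbn⟩, ?_⟩, ?_⟩
  · rw [hlt b hbn.le]; exact hnb
  · rw [hge a (by omega)]; omega
  · have hsub : (Finset.univ.filter fun i : Fin n => (i : ℕ) < a) ∪
        (Finset.univ.filter fun i : Fin n => b ≤ (i : ℕ)) ⊆
        ((Finset.univ.filter fun i : Fin n => (i : ℕ) < b) ∩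
          Finset.univ.filter fun i : Fin n => a ≤ (i : ℕ))ᶜ := by
      intro i
      simp only [Finset.mem_union, Finset.mem_filter, Finset.mem_univ, true_and,
        Finset.mem_compl, Finset.mem_inter]
      omega
    have hle := Finset.card_le_card hsub
    rw [Finset.card_union_of_disjoint, hlt a (by omega), hge b hbn.le] at hle
    · omega
    · rw [Finset.disjoint_filter]
      omega
  · simp; omega
  · simp; omega
  · intro i
    simp only [Finset.mem_filter, Finset.mem_univ, true_and]
    omega

end ByzantineConsensus

open ByzantineConsensus in
theorem theorem1 {VI : Type u} {VO : Type v} [Nonempty VI] (n t : ℕ) (ht : 0 < t) (htn : t < n)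
    (hn : n ≤ 3 * t) (δ : ℝ) (hδ : 0 < δ)
    (val : ByzantineConsensus.ValidityProperty n t VI VO)
    (hval : ByzantineConsensus.ValidityProperty.Solvable.{u, v, w} val δ) :
    val.IsTrivial := by
  obtain ⟨A, hA⟩ := hval
  -- The round length `h` has to divide `A.tick` and must not exceed `δ`.
  obtain ⟨N, h, hh, hhδ, htick⟩ : ∃ (N : ℕ) (h : ℝ), 0 < h ∧ h ≤ δ ∧ A.tick = N * h := by
    obtain ⟨M, hM⟩ := exists_nat_ge (A.tick / δ)
    have hM0 : (0 : ℝ) < M := (div_pos A.tick_pos hδ).trans_le hM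
    refine ⟨M, A.tick / M, div_pos A.tick_pos hM0, ?_, by field_simp⟩
    rw [div_le_iff₀ hδ] at hM
    rw [div_le_iff₀ hM0]
    linarith
  obtain ⟨Q₁, Q₂, hQ₁, hQ₂, hQ, ⟨i, hi⟩, ⟨j, hj⟩, hcover⟩ := exists_cover ht htn hn
  have hi₁ := (Finset.mem_sdiff.mp hi).1
  have hj₂ := (Finset.mem_sdiff.mp hj).1
  have hE₁ : ∀ x, (quietRun A h Q₁ x).IsExecution t δ :=
    fun x => quietRun_isExecution hh hhδ htick hQ₁
  have hE₂ : ∀ x, (quietRun A h Q₂ x).IsExecution t δ :=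
    fun x => quietRun_isExecution hh hhδ htick hQ₂
  choose d₁ hd₁ using fun x => hA.termination _ (hE₁ x) i hi₁
  choose d₂ hd₂ using fun x => hA.termination _ (hE₂ x) j hj₂
  have heq : ∀ x y, d₁ x = d₂ y := fun x y =>
    quietRun_decides_eq hA hh hhδ htick hQ hi hj (hd₁ x) (hd₂ y)
  let x₀ : Fin n → VI := fun _ => Classical.arbitrary VI
  have hv₁ : ∀ p ∈ Q₁, ∀ x, (quietRun A h Q₁ x).Decides p (d₁ x₀) := by
    intro p hp x
    obtain ⟨v', hv'⟩ := hA.termination _ (hE₁ x) p hp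
    have := hA.agreement _ (hE₁ x) p hp i hi₁ _ _ hv' (hd₁ x)
    rwa [this, (heq x x₀).trans (heq x₀ x₀).symm] at hv'
  have hv₂ : ∀ p ∈ Q₂, ∀ x, (quietRun A h Q₂ x).Decides p (d₁ x₀) := by
    intro p hp x
    obtain ⟨v', hv'⟩ := hA.termination _ (hE₂ x) p hp
    have := hA.agreement _ (hE₂ x) p hp j hj₂ _ _ hv' (hd₂ x)
    rwa [this, ← heq x₀ x] at hv'
  refine ⟨d₁ x₀, Set.mem_iInter.mpr fun c => ?_⟩
  obtain ⟨p, hp⟩ : ∃ p, (c.proposal p).isSome = true := by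
    by_contra! hnone
    have hcard := c.card_le
    rw [Finset.filter_false_of_mem fun p _ => hnone p, Finset.card_empty] at hcard
    omega
  rcases hcover p with hpQ | hpQ
  · exact mem_admissible_of_quietRun_decides hA hh hhδ htick hpQ hp (hv₁ p hpQ)
  · exact mem_admissible_of_quietRun_decides hA hh hhδ htick hpQ hp (hv₂ p hpQ)
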